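/- Graphs are simple. For a graph \(H\) and \(n\ge 0\), the Cartesian power \(H^n\) has as vertices the \(n\)-tuples of vertices of \(H\), with \(\mathbf u\sim\mathbf u'\) if there is an \(i\) with \(u_i\sim u_i'\) in \(H\) and \(u_j=u_j'\) for all \(j\ne i\). Two spanning trees of a graph are completely independent if they have no common edge and, for all vertices \(u,v\), the \(u\)–\(v\) paths in the two trees have no common vertices other than \(u\) and \(v\); a family of spanning trees is completely independent if any two members with different indices are. The radius is \(r(H)=\min_{u}\max_{v}d_H(u,v)\). Theorem. Let \(H\) be any connected graph of finite radius \(r(H)\) (for example, any finite connected graph). (1) For every positive integer \(k\) and every \(n\ge 6\cdot 2^k+k+4\), the Cartesian power \(H^n\) has a family of \(2^k\) completely independent spanning trees, each of diameter at most \(2(n+5k+1)r(H)+4k+10\). (2) If \(H\) has at least two vertices, this bound is \((2+o(1))\,n\cdot r(H)\) as \(n\to\infty\), where \(k=k(n)\) may vary with \(n\) in any way subject to \(6\cdot 2^{k}+k+4\le n\) for all large \(n\). (3) For every \(n\ge 0\), every spanning tree of \(H^n\) has diameter at least \(2n\cdot r(H)-1\). Hence the diameter in (1) is asymptotically optimal.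 -/

import Mathlib

open Filter Asymptotics

/-- The Cartesian power `H^n`: vertices are `n`-tuples of vertices of `H`, two of them being adjacent
when they are adjacent in `H` in some coordinate and agree in all the others. -/
def cartesianPower {V : Type*} (H : SimpleGraph V) (n : ℕ) : SimpleGraph (Fin n → V) where
  Adj u v := ∃ i, H.Adj (u i) (v i) ∧ ∀ j, j ≠ i → u j = v j
  symm := ⟨by
    rintro u v ⟨i, hi, h⟩
    exact ⟨i, hi.symm, fun j hj => (h j hj).symm⟩⟩
  loopless := ⟨by
    rintro u ⟨i, hi, -⟩
    exact H.irrefl hi⟩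

/-- `T` is a spanning tree of `G` (a tree on the whole vertex set, all of whose edges are in `G`). -/
def IsSpanningTree {W : Type*} (G T : SimpleGraph W) : Prop :=
  T ≤ G ∧ T.IsTree

/-- Two trees on the same vertex set are completely independent: they have no common edge, and for
all `u`, `v`, the `u`-`v` paths in the two trees have no common vertex other than `u` and `v`. -/
def CompletelyIndependent {W : Type*} (T₁ T₂ : SimpleGraph W) : Prop :=
  Disjoint T₁.edgeSet T₂.edgeSet ∧
    ∀ (u v : W) (p : T₁.Walk u v) (q : T₂.Walk u v), p.IsPath → q.IsPath →
      ∀ x, x ∈ p.support → x ∈ q.support → x = u ∨ x = v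

/-! Upper bound. Colour the vertices of `H^n` by `K = F₂^k`. The tree of colour `c` spans class `c`
and hangs every other vertex on it as a leaf, so its vertices of degree at least two all have colour
`c`. Hence paths in different trees are internally disjoint, and a common edge would have to join
two vertices attached to each other (`exists_completelyIndependent_of_coloring`).

The colouring needs one control coordinate and two banks, each holding two coordinates per label in
`K`. The parity of the control entry selects a bank, and the colour is the sum of the labels at odd
entries of that bank. One parity flip in the selected bank reaches any colour; having two copies of
each label allows the attachments to be oriented (`attachTo_attachTo_ne`). The unselected bank can
be rewritten without changing the colour, so a class has small radius (`edist_bankColor_class_le`).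
This uses `4 * 2 ^ k + 1` coordinates and gives diameter at most `2 * (n * r + 4)`, within the
stated bound.

Lower bound. The middle of a longest path of a tree is within about half the diameter of every
vertex, whereas in `H^n` every vertex has another at distance at least `n * r`, chosen coordinate by
coordinate. -/

section Trees

variable {W : Type*}

/-! ### The centre of a tree -/

theorem SimpleGraph.IsTree.eq_of_dist_add_one_eq {T : SimpleGraph W} (hT : T.IsTree) {w x y z : W}
    (hy : T.Adj x y) (hz : T.Adj x z) (hdy : T.dist y w + 1 = T.dist x w)
    (hdz : T.dist z w + 1 = T.dist x w) : y = z := by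
  obtain ⟨p, hp⟩ := hT.connected.exists_walk_length_eq_dist y w
  obtain ⟨q, hq⟩ := hT.connected.exists_walk_length_eq_dist z w
  have hp' : (SimpleGraph.Walk.cons hy p).IsPath :=
    SimpleGraph.Walk.isPath_of_length_eq_dist _ (by simp [hp, hdy])
  have hq' : (SimpleGraph.Walk.cons hz q).IsPath :=
    SimpleGraph.Walk.isPath_of_length_eq_dist _ (by simp [hq, hdz])
  have h := congrArg SimpleGraph.Walk.snd (congrArg Subtype.val
    ((hT.isAcyclic.subsingleton_path x w).elim ⟨_, hp'⟩ ⟨_, hq'⟩))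
  simpa using h

/-- Once `f` ascends it ascends to the end, so `f` is V-shaped and is monotone with slope one on at
least one side of `a`. -/
theorem eq_add_of_no_strict_local_max {f : ℕ → ℕ} {D a : ℕ} (ha : a ≤ D)
    (hstep : ∀ i < D, f (i + 1) = f i + 1 ∨ f i = f (i + 1) + 1)
    (hmax : ∀ i, i + 1 < D → f (i + 1) = f i + 1 → f (i + 2) = f (i + 1) + 1) :
    f D = f a + (D - a) ∨ f 0 = f a + a := by
  have hasc : ∀ i j, i + 1 + j ≤ D → f (i + 1) = f i + 1 → f (i + 1 + j) = f i + 1 + j := by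
    intro i j hij hi
    suffices h : f (i + 1 + j) = f i + 1 + j ∧ f (i + 1 + j) = f (i + j) + 1 from h.1
    induction j with
    | zero => exact ⟨hi, hi⟩
    | succ j ih =>
      obtain ⟨h₁, h₂⟩ := ih (by omega)
      have := hmax (i + j) (by omega) (by rw [← h₂]; congr 1; omega)
      have e₁ : i + j + 2 = i + 1 + (j + 1) := by omega
      have e₂ : i + j + 1 = i + 1 + j := by omega
      have e₃ : i + (j + 1) = i + 1 + j := by omega
      rw [e₁, e₂] at this
      rw [e₃]
      omega
  by_cases h : ∃ i < a, f (i + 1) = f i + 1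
  · obtain ⟨i, hia, hi⟩ := h
    left
    have h₁ := hasc i (a - (i + 1)) (by omega) hi
    have h₂ := hasc i (D - (i + 1)) (by omega) hi
    rw [show i + 1 + (a - (i + 1)) = a by omega] at h₁
    rw [show i + 1 + (D - (i + 1)) = D by omega] at h₂
    omega
  · push Not at h
    right
    have hdesc : ∀ j ≤ a, f 0 = f j + j := by
      intro j
      induction j with
      | zero => simp
      | succ j ih =>
        intro hj
        have h₁ := ih (by omega)
        have h₂ := h j (by omega)
        have h₃ := hstep j (by omega)
        omega
    exact hdesc a le_rfl

theorem SimpleGraph.IsTree.exists_two_mul_dist_le {T : SimpleGraph W} (hT : T.IsTree)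
    (hfin : T.ediam ≠ ⊤) : ∃ m, ∀ w, 2 * T.dist m w ≤ T.diam + 1 := by
  have := hT.connected.nonempty
  obtain ⟨u, v, huv⟩ := T.exists_dist_eq_diam
  obtain ⟨p, hpath, hp⟩ := hT.connected.exists_path_of_dist u v
  set D := T.diam
  have hlen : p.length = D := hp.trans huv
  refine ⟨p.getVert (D / 2), fun w => ?_⟩
  have hadj : ∀ i < D, T.Adj (p.getVert i) (p.getVert (i + 1)) := fun i hi =>
    p.adj_getVert_succ (by omega)
  have hstep : ∀ i < D, T.dist (p.getVert (i + 1)) w = T.dist (p.getVert i) w + 1 ∨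
      T.dist (p.getVert i) w = T.dist (p.getVert (i + 1)) w + 1 := by
    intro i hi
    have := hT.dist_eq_dist_add_one_of_adj w (hadj i hi)
    rw [SimpleGraph.dist_comm (u := w), SimpleGraph.dist_comm (u := w)] at this
    omega
  have key := eq_add_of_no_strict_local_max (f := fun i => T.dist (p.getVert i) w)
    (D := D) (a := D / 2) (by omega) hstep (by
      intro i hi h
      refine (hstep (i + 1) hi).resolve_right fun h' => ?_
      -- At a local maximum both path neighbours would be closer to `w`; in a tree only one
      -- neighbour is.
      have := hT.eq_of_dist_add_one_eq (hadj i (by omega)).symm (hadj (i + 1) hi) h.symm h'.symm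
      have := hpath.getVert_injOn (by simp; omega) (by simp; omega) this
      omega)
  have hv : T.dist (p.getVert D) w ≤ D := SimpleGraph.dist_le_diam hfin
  have hu : T.dist (p.getVert 0) w ≤ D := SimpleGraph.dist_le_diam hfin
  omega

/-! ### Trees from parent maps, and independence from colourings -/

/-- The graph joining every vertex other than the root `z` to its parent. -/
def parentGraph (z : W) (par : W → W) : SimpleGraph W :=
  SimpleGraph.fromRel fun x y => x ≠ z ∧ par x = y

variable {z : W} {par : W → W} {h : W → ℕ}

theorem parentGraph_adj_parent (hpar : ∀ x, x ≠ z → h (par x) < h x) {x : W} (hx : x ≠ z) :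
    (parentGraph z par).Adj x (par x) := by
  refine (SimpleGraph.fromRel_adj _ _ _).2 ⟨fun e => ?_, Or.inl ⟨hx, rfl⟩⟩
  have := hpar x hx
  rw [← e] at this
  exact lt_irrefl _ this

theorem edist_parentGraph_le (hpar : ∀ x, x ≠ z → h (par x) < h x) (x : W) :
    (parentGraph z par).edist x z ≤ h x := by
  induction hn : h x using Nat.strong_induction_on generalizing x with
  | _ n ih =>
    by_cases hx : x = z
    · simp [hx]
    have hlt := hpar x hx
    calc (parentGraph z par).edist x z
        ≤ (parentGraph z par).edist x (par x) + (parentGraph z par).edist (par x) z :=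
          SimpleGraph.edist_triangle
      _ ≤ 1 + h (par x) := by
          gcongr
          · exact (SimpleGraph.edist_eq_one_iff_adj.2 (parentGraph_adj_parent hpar hx)).le
          · exact ih _ (hn ▸ hlt) _ rfl
      _ ≤ n := by norm_cast; omega

/-- On a cycle, both neighbours of a vertex of maximal height would have to be its parent. -/
theorem isTree_parentGraph (hpar : ∀ x, x ≠ z → h (par x) < h x) :
    (parentGraph z par).IsTree := by
  classical
  have hreach : ∀ x, (parentGraph z par).Reachable x z := fun x =>
    SimpleGraph.reachable_of_edist_ne_top
      (ne_top_of_le_ne_top (ENat.natCast_ne_top (h x)) (edist_parentGraph_le hpar x))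
  have : Nonempty W := ⟨z⟩
  refine ⟨⟨fun x y => (hreach x).trans (hreach y).symm⟩, fun v c hc => ?_⟩
  obtain ⟨x, hx, hmax⟩ := c.support.toFinset.exists_max_image h ⟨v, by simp⟩
  rw [List.mem_toFinset] at hx
  have hc' := (SimpleGraph.Walk.isCycle_rotate hx).2 hc
  set d := c.rotate x hx
  have hup : ∀ y ∈ d.support, (parentGraph z par).Adj x y → par x = y := by
    intro y hy hxy
    have hyx : h y ≤ h x := hmax y (by
      rw [List.mem_toFinset]; exact (SimpleGraph.Walk.mem_support_rotate_iff _ _ _).1 hy)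
    rcases ((SimpleGraph.fromRel_adj _ _ _).1 hxy).2 with h' | h'
    · exact h'.2
    · have := hpar y h'.1
      rw [h'.2] at this
      omega
  exact hc'.snd_ne_penultimate
    ((hup _ (d.getVert_mem_support _) (d.adj_snd hc'.not_nil)).symm.trans
      (hup _ (d.getVert_mem_support _) (d.adj_penultimate hc'.not_nil).symm))

theorem ediam_parentGraph_le (hpar : ∀ x, x ≠ z → h (par x) < h x) {R : ℕ} (hR : ∀ x, h x ≤ R) :
    (parentGraph z par).ediam ≤ (2 * R : ℕ) := by
  refine SimpleGraph.ediam_le_of_edist_le fun u v => ?_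
  calc (parentGraph z par).edist u v
      ≤ (parentGraph z par).edist u z + (parentGraph z par).edist z v :=
        SimpleGraph.edist_triangle
    _ ≤ (R : ℕ∞) + R := by
        rw [SimpleGraph.edist_comm (u := z)]
        gcongr
        · exact (edist_parentGraph_le hpar u).trans (by exact_mod_cast hR u)
        · exact (edist_parentGraph_le hpar v).trans (by exact_mod_cast hR v)
    _ = (2 * R : ℕ) := by norm_cast; omega

theorem SimpleGraph.Walk.IsPath.exists_adj_adj_ne {T : SimpleGraph W} {u v x : W} {p : T.Walk u v}
    (hp : p.IsPath) (hx : x ∈ p.support) (hu : x ≠ u) (hv : x ≠ v) :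
    ∃ y y', y ≠ y' ∧ T.Adj x y ∧ T.Adj x y' := by
  obtain ⟨i, rfl, hi⟩ := SimpleGraph.Walk.mem_support_iff_exists_getVert.1 hx
  obtain _ | i := i
  · simp at hu
  have hi' : i + 1 < p.length := lt_of_le_of_ne hi (by rintro h; simp [h] at hv)
  refine ⟨p.getVert i, p.getVert (i + 2), fun e => ?_, (p.adj_getVert_succ (by omega)).symm,
    p.adj_getVert_succ hi'⟩
  have := hp.getVert_injOn (by simp; omega) (by simp; omega) e
  omega

theorem completelyIndependent_of_inner {T₁ T₂ : SimpleGraph W} {s₁ s₂ : Set W}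
    (hs : Disjoint s₁ s₂) (hE : ∀ x y, T₁.Adj x y → ¬ T₂.Adj x y)
    (h₁ : ∀ x y y', y ≠ y' → T₁.Adj x y → T₁.Adj x y' → x ∈ s₁)
    (h₂ : ∀ x y y', y ≠ y' → T₂.Adj x y → T₂.Adj x y' → x ∈ s₂) :
    CompletelyIndependent T₁ T₂ := by
  refine ⟨Set.disjoint_left.2 fun e => ?_, fun u v p q hp hq x hxp hxq => ?_⟩
  · induction e with
    | _ x y => exact hE x y
  · by_contra! hne
    obtain ⟨y, y', hy, ha, hb⟩ := hp.exists_adj_adj_ne hxp hne.1 hne.2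
    obtain ⟨z, z', hz, hc, hd⟩ := hq.exists_adj_adj_ne hxq hne.1 hne.2
    exact Set.disjoint_left.1 hs (h₁ x y y' hy ha hb) (h₂ x z z' hz hc hd)

/-- A colouring with colour classes of bounded radius, together with an edge-disjoint way to attach
every vertex to every colour class, yields completely independent spanning trees. -/
theorem exists_completelyIndependent_of_coloring {K : Type*} (G : SimpleGraph W) (color : W → K)
    (ctr : K → W) (hctr : ∀ c, color (ctr c) = c) (R : ℕ)
    (hR : ∀ x, ((SimpleGraph.induce {y | color y = color x} G).edist ⟨x, rfl⟩
      ⟨ctr (color x), hctr _⟩) ≤ R)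
    (att : W → K → W) (hatt : ∀ x c, G.Adj x (att x c)) (hcol : ∀ x c, color (att x c) = c)
    (hanti : ∀ x y, att x (color y) = y → att y (color x) ≠ x) :
    ∃ T : K → SimpleGraph W, (∀ c, IsSpanningTree G (T c)) ∧
      (∀ c d, c ≠ d → CompletelyIndependent (T c) (T d)) ∧
      ∀ c, (T c).ediam ≤ (2 * (R + 1) : ℕ) := by
  classical
  have hex : ∀ c, ∃ (par : W → W) (h : W → ℕ), (∀ x, x ≠ ctr c → h (par x) < h x) ∧
      (∀ x, h x ≤ R + 1) ∧ (∀ x, x ≠ ctr c → G.Adj x (par x)) ∧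
      (∀ x, x ≠ ctr c → color (par x) = c) ∧ ∀ x, color x ≠ c → par x = att x c := by
    intro c
    let Gc := SimpleGraph.induce {y | color y = c} G
    have hRc : ∀ x (hx : color x = c), Gc.edist ⟨x, hx⟩ ⟨ctr c, hctr c⟩ ≤ R := by
      rintro x rfl
      exact hR x
    have hreach : ∀ x (hx : color x = c), Gc.Reachable ⟨x, hx⟩ ⟨ctr c, hctr c⟩ := fun x hx =>
      SimpleGraph.reachable_of_edist_ne_top
        (ne_top_of_le_ne_top (ENat.natCast_ne_top R) (hRc x hx))
    have : Nonempty W := ⟨ctr c⟩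
    have hnext : ∀ x, color x = c → x ≠ ctr c → ∃ y, G.Adj x y ∧ color y = c ∧
        ∀ (hx : color x = c) (hy : color y = c),
          Gc.dist ⟨y, hy⟩ ⟨ctr c, hctr c⟩ < Gc.dist ⟨x, hx⟩ ⟨ctr c, hctr c⟩ := by
      intro x hx hne
      obtain ⟨p, hp⟩ := (hreach x hx).exists_walk_length_eq_dist
      cases p with
      | nil => exact absurd rfl hne
      | @cons _ y _ hadj q =>
        refine ⟨y, hadj, y.2, fun _ _ => ?_⟩
        rw [← hp]
        exact Nat.lt_succ_of_le (SimpleGraph.dist_le q)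
    choose! nxt hnxt hcolor hlt using hnext
    refine ⟨fun x => if hx : color x = c then nxt x else att x c,
      -- Height `R + 1` places all vertices outside the class above the whole class.
      fun x => if hx : color x = c then Gc.dist ⟨x, hx⟩ ⟨ctr c, hctr c⟩ else R + 1,
      fun x hx => ?_, fun x => ?_, fun x hx => ?_, fun x hx => ?_, fun x hx => ?_⟩
    · by_cases hc : color x = c
      · have hy := hcolor x hc hx
        simpa [hc, hy] using hlt x hc hx hc hy
      · simp only [hc, dif_neg, not_false_eq_true, hcol, dite_true]
        have := hRc _ (hcol x c)
        rw [← (hreach _ (hcol x c)).coe_dist_eq_edist] at this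
        exact Nat.lt_succ_of_le (by exact_mod_cast this)
    · by_cases hc : color x = c
      · have := hRc x hc
        rw [← (hreach x hc).coe_dist_eq_edist] at this
        simp only [hc, dite_true]
        exact Nat.le_succ_of_le (by exact_mod_cast this)
      · simp [hc]
    · by_cases hc : color x = c
      · simpa [hc] using hnxt x hc hx
      · simpa [hc] using hatt x c
    · by_cases hc : color x = c
      · simpa [hc] using hcolor x hc hx
      · simp [hc, hcol]
    · simp [hx]
  choose par h hpar hle hadj hparc hleaf using hex
  have hT : ∀ c x y, (parentGraph (ctr c) (par c)).Adj x y →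
      (x ≠ ctr c ∧ par c x = y ∧ color y = c) ∨ (y ≠ ctr c ∧ par c y = x ∧ color x = c) := by
    intro c x y hxy
    rcases ((SimpleGraph.fromRel_adj _ _ _).1 hxy).2 with h' | h'
    · exact Or.inl ⟨h'.1, h'.2, h'.2 ▸ hparc c x h'.1⟩
    · exact Or.inr ⟨h'.1, h'.2, h'.2 ▸ hparc c y h'.1⟩
  have hinner : ∀ c x y y', y ≠ y' → (parentGraph (ctr c) (par c)).Adj x y →
      (parentGraph (ctr c) (par c)).Adj x y' → x ∈ {x | color x = c} := by
    intro c x y y' hne hy hy'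
    rcases hT c x y hy with h₁ | h₁
    · rcases hT c x y' hy' with h₂ | h₂
      · exact absurd (h₁.2.1.symm.trans h₂.2.1) hne
      · exact h₂.2.2
    · exact h₁.2.2
  have hopp : ∀ c d x y, c ≠ d → par c x = y → color y = c → par d y = x → color x = d →
      False := by
    rintro c d x y hcd hx hy hy' hx'
    rw [hleaf c x (by rw [hx']; exact hcd.symm)] at hx
    rw [hleaf d y (by rw [hy]; exact hcd)] at hy'
    subst hy hx'
    exact hanti x y hx hy'
  refine ⟨fun c => parentGraph (ctr c) (par c),
    fun c => ⟨fun x y hxy => ?_, isTree_parentGraph (hpar c)⟩, fun c d hcd => ?_,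
    fun c => ediam_parentGraph_le (hpar c) (hle c)⟩
  · rcases hT c x y hxy with h' | h'
    · exact h'.2.1 ▸ hadj c x h'.1
    · exact (h'.2.1 ▸ hadj c y h'.1).symm
  · refine completelyIndependent_of_inner (s₁ := {x | color x = c}) (s₂ := {x | color x = d})
      (Set.disjoint_left.2 fun x hx hx' => hcd (hx.symm.trans hx')) (fun x y hc hd => ?_)
      (hinner c) (hinner d)
    rcases hT c x y hc with h₁ | h₁ <;> rcases hT d x y hd with h₂ | h₂
    · exact hcd (h₁.2.2.symm.trans h₂.2.2)
    · exact hopp c d x y hcd h₁.2.1 h₁.2.2 h₂.2.1 h₂.2.2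
    · exact hopp c d y x hcd h₁.2.1 h₁.2.2 h₂.2.1 h₂.2.2
    · exact hcd (h₁.2.2.symm.trans h₂.2.2)

end Trees

/-! ### Lower bound and asymptotics -/

section LowerBound

variable {V : Type*} {H : SimpleGraph V}

theorem sum_dist_le_length (hH : H.Connected) {n : ℕ} {u v : Fin n → V}
    (p : (cartesianPower H n).Walk u v) : ∑ i, H.dist (u i) (v i) ≤ p.length := by
  classical
  induction p with
  | nil => simp
  | @cons a b c hadj q ih =>
    obtain ⟨i, hi, hne⟩ := id hadj
    calc ∑ j, H.dist (a j) (c j)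
        ≤ ∑ j, ((if j = i then 1 else 0) + H.dist (b j) (c j)) := by
          refine Finset.sum_le_sum fun j _ => ?_
          by_cases hj : j = i
          · subst hj
            simpa [SimpleGraph.dist_eq_one_iff_adj.2 hi] using
              hH.dist_triangle (u := a j) (v := b j) (w := c j)
          · simp [hj, hne j hj]
      _ ≤ (SimpleGraph.Walk.cons hadj q).length := by
          rw [Finset.sum_add_distrib]
          simp
          omega

theorem exists_le_dist_of_radius (hH : H.Connected) {r : ℕ} (hr : H.radius = (r : ℕ∞)) (u : V) :
    ∃ v, r ≤ H.dist u v := by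
  by_contra! hlt
  have hpos : 0 < r := (Nat.zero_le _).trans_lt (hlt u)
  have : H.radius ≤ ((r - 1 : ℕ) : ℕ∞) := SimpleGraph.radius_le_eccent.trans
    ((SimpleGraph.eccent_le_iff u _).2 fun v => by
      rw [← (hH u v).coe_dist_eq_edist]
      exact_mod_cast Nat.le_sub_one_of_lt (hlt v))
  rw [hr] at this
  have := ENat.natCast_le_natCast.1 this
  omega

theorem le_ediam_of_isSpanningTree {n r : ℕ} (hH : H.Connected)
    (hr : H.radius = (r : ℕ∞)) {T : SimpleGraph (Fin n → V)}
    (hT : IsSpanningTree (cartesianPower H n) T) :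
    ((2 * n * r : ℕ) : ℕ∞) ≤ T.ediam + 1 := by
  by_cases hfin : T.ediam = ⊤
  · simp [hfin]
  obtain ⟨m, hm⟩ := hT.2.exists_two_mul_dist_le hfin
  choose far hfar using exists_le_dist_of_radius hH hr
  obtain ⟨p, hp⟩ := hT.2.connected.exists_walk_length_eq_dist m fun i => far (m i)
  have h₁ := sum_dist_le_length hH (p.mapLe hT.1)
  have h₂ : n * r ≤ ∑ i, H.dist (m i) (far (m i)) := by
    simpa using Finset.sum_le_sum fun i (_ : i ∈ Finset.univ) => hfar (m i)
  have h₃ := hm fun i => far (m i)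
  rw [SimpleGraph.Walk.length_mapLe, hp] at h₁
  rw [← ENat.natCast_toNat hfin]
  change _ ≤ ((T.diam : ℕ) : ℕ∞) + 1
  norm_cast
  rw [mul_assoc]
  omega

theorem diameter_bound_isEquivalent {r : ℕ} (hr : r ≠ 0) {κ : ℕ → ℕ}
    (hκ : ∀ᶠ n in atTop, 6 * 2 ^ κ n + κ n + 4 ≤ n) :
    (fun n : ℕ => 2 * ((n : ℝ) + 5 * (κ n : ℝ) + 1) * (r : ℝ) + 4 * (κ n : ℝ) + 10)
      ~[atTop] (fun n : ℕ => 2 * (n : ℝ) * (r : ℝ)) := by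
  have hid : (fun _ : ℕ => (1 : ℝ)) =o[atTop] fun n : ℕ => (n : ℝ) :=
    isLittleO_const_left.2 (Or.inr (tendsto_norm_atTop_atTop.comp tendsto_natCast_atTop_atTop))
  -- This quadratic bound suffices: it gives `κ n = O(√n)`, hence `o(n)`.
  have hsq : ∀ m : ℕ, m ^ 2 ≤ 6 * 2 ^ m := by
    intro m
    induction m with
    | zero => simp
    | succ m ih =>
      have := Nat.lt_two_pow_self (n := m)
      rw [pow_succ 2 m]
      nlinarith
  have hκo : (fun n => (κ n : ℝ)) =o[atTop] fun n : ℕ => (n : ℝ) := by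
    have hbig : (fun n => (κ n : ℝ)) =O[atTop] fun n : ℕ => Real.sqrt n := by
      refine IsBigO.of_bound 1 (hκ.mono fun n hn => ?_)
      have : κ n ^ 2 ≤ n := (hsq _).trans (by omega)
      simp only [Real.norm_natCast, one_mul, Real.norm_of_nonneg (Real.sqrt_nonneg _)]
      exact Real.le_sqrt_of_sq_le (by exact_mod_cast this)
    refine hbig.trans_isLittleO ?_
    have hone : (fun _ : ℕ => (1 : ℝ)) =o[atTop] fun n : ℕ => Real.sqrt n :=
      isLittleO_const_left.2 (Or.inr (tendsto_norm_atTop_atTop.comp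
        (Real.tendsto_sqrt_atTop.comp tendsto_natCast_atTop_atTop)))
    refine (hone.mul_isBigO (isBigO_refl (fun n : ℕ => Real.sqrt n) atTop)).congr (fun n => ?_)
      fun n => ?_
    · exact one_mul _
    · exact Real.mul_self_sqrt n.cast_nonneg
  have hmain : (fun n : ℕ => (10 * (r : ℝ) + 4) * (κ n : ℝ) + (2 * (r : ℝ) + 10) * 1)
      =o[atTop] fun n : ℕ => (n : ℝ) :=
    (hκo.const_mul_left _).add (hid.const_mul_left _)
  have hr' : (2 * (r : ℝ)) ≠ 0 := by positivity
  refine ((isLittleO_const_mul_right_iff hr').2 hmain).congr (fun n => ?_) fun n => ?_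
  · simp only [Pi.sub_apply]
    ring
  · ring

end LowerBound

/-! ### Moves in subcubes of the Cartesian power -/

section Construction

variable {V : Type*} {H : SimpleGraph V} {n : ℕ}

/-- The coordinates in `I` are moved one after another along shortest walks of `H`; `hs` keeps every
intermediate tuple in `s`. -/
theorem edist_induce_cartesianPower_le {s : Set (Fin n → V)} (I : Finset (Fin n)) (x y : s)
    (hxy : ∀ i ∉ I, (y : Fin n → V) i = x.1 i)
    (hs : ∀ u : Fin n → V, (∀ i ∉ I, u i = x.1 i) → u ∈ s) :
    (SimpleGraph.induce s (cartesianPower H n)).edist x y ≤ ∑ i ∈ I, H.edist (x.1 i) (y.1 i) := by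
  classical
  induction I using Finset.induction_on generalizing x with
  | empty =>
    have : x = y := Subtype.ext (funext fun i => (hxy i (Finset.notMem_empty i)).symm)
    simp [this]
  | @insert i I hi ih =>
    have hmem : ∀ v, Function.update x.1 i v ∈ s := fun v => hs _ fun j hj =>
      Function.update_of_ne (by rintro rfl; exact hj (Finset.mem_insert_self _ _)) _ _
    let φ : H →g SimpleGraph.induce s (cartesianPower H n) :=
      { toFun := fun v => ⟨Function.update x.1 i v, hmem v⟩
        map_rel' := fun {a b} hab => ⟨i, by simpa using hab, fun j hj => by simp [hj]⟩ }
    have hφv : ∀ v j, (φ v).1 j = Function.update x.1 i v j := fun _ _ => rfl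
    have hφ : φ (x.1 i) = x := Subtype.ext (Function.update_eq_self _ _)
    have h₁ : (SimpleGraph.induce s (cartesianPower H n)).edist x (φ (y.1 i))
        ≤ H.edist (x.1 i) (y.1 i) := by
      by_cases htop : H.edist (x.1 i) (y.1 i) = ⊤
      · simp [htop]
      obtain ⟨p, hp⟩ := SimpleGraph.exists_walk_of_edist_ne_top htop
      rw [← hp, ← SimpleGraph.Walk.length_map φ]
      conv_lhs => rw [← hφ]
      exact SimpleGraph.edist_le _
    have h₂ := ih (φ (y.1 i)) (fun j hj => by
        by_cases hji : j = i
        · subst hji; simp [hφv]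
        · simpa [hφv, hji] using hxy j (by simp [hji, hj]))
      (fun u hu => hs u fun j hj => by
        rw [Finset.mem_insert, not_or] at hj
        simpa [hφv, hj.1] using hu j hj.2)
    rw [Finset.sum_insert hi]
    refine SimpleGraph.edist_triangle.trans (add_le_add h₁ (h₂.trans_eq ?_))
    refine Finset.sum_congr rfl fun j hj => ?_
    have hji : j ≠ i := fun h => hi (h ▸ hj)
    simp [hφv, hji]

/-- Replace one entry of a tuple by its image under `f`. -/
def stepAt (f : V → V) (u : Fin n → V) (i : Fin n) : Fin n → V :=
  Function.update u i (f (u i))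

theorem stepAt_of_ne {f : V → V} {u : Fin n → V} {i j : Fin n} (h : j ≠ i) :
    stepAt f u i j = u j := Function.update_of_ne h _ _

theorem stepAt_self {f : V → V} {u : Fin n → V} {i : Fin n} :
    stepAt f u i i = f (u i) := Function.update_self _ _ _

theorem cartesianPower_adj_stepAt {f : V → V} (hf : ∀ v, H.Adj v (f v)) (u : Fin n → V)
    (i : Fin n) : (cartesianPower H n).Adj u (stepAt f u i) :=
  ⟨i, by rw [stepAt_self]; exact hf _, fun _ hj => (stepAt_of_ne hj).symm⟩

/-! ### The checksum colouring with two banks -/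

variable {K : Type*}

/-- The bank that is selected by the control coordinate. -/
def activeBank (p : V → ZMod 2) (e : Option (Bool × K × Bool) → Fin n) (u : Fin n → V) : Bool :=
  decide (p (u (e none)) = 0)

variable {p : V → ZMod 2} {f : V → V} {e : Option (Bool × K × Bool) → Fin n}

theorem activeBank_stepAt_of_ne {i : Fin n} {u : Fin n → V} (h : e none ≠ i) :
    activeBank p e (stepAt f u i) = activeBank p e u := by
  rw [activeBank, stepAt_of_ne h, activeBank]

theorem activeBank_stepAt (hp : ∀ v, p (f v) = p v + 1) (u : Fin n → V) :
    activeBank p e (stepAt f u (e none)) = !activeBank p e u := by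
  simp only [activeBank, stepAt_self, hp]
  generalize p (u (e none)) = a
  revert a
  decide

variable [Fintype K] [AddCommGroup K] [Module (ZMod 2) K]

/-- The checksum of one of two banks of coordinates: the sum of the labels of the coordinates of
that bank whose entry is odd. -/
def bankSum (p : V → ZMod 2) (e : Option (Bool × K × Bool) → Fin n) (b : Bool) (u : Fin n → V) : K :=
  ∑ x : K × Bool, p (u (e (some (b, x)))) • x.1

/-- The colour of a tuple is the checksum of its active bank. -/
def bankColor (p : V → ZMod 2) (e : Option (Bool × K × Bool) → Fin n) (u : Fin n → V) : K :=
  bankSum p e (activeBank p e u) u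

theorem bankSum_congr {b : Bool} {u v : Fin n → V}
    (h : ∀ x, u (e (some (b, x))) = v (e (some (b, x)))) : bankSum p e b u = bankSum p e b v := by
  simp only [bankSum, h]

theorem bankSum_stepAt (he : Function.Injective e) (hp : ∀ v, p (f v) = p v + 1) (b : Bool)
    (x : K × Bool) (u : Fin n → V) :
    bankSum p e b (stepAt f u (e (some (b, x)))) = bankSum p e b u + x.1 := by
  classical
  have : ∀ y : K × Bool, p (stepAt f u (e (some (b, x))) (e (some (b, y)))) • y.1
      = p (u (e (some (b, y)))) • y.1 + if y = x then x.1 else 0 := by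
    intro y
    by_cases hy : y = x
    · subst hy
      simp [stepAt_self, hp, add_smul]
    · rw [stepAt_of_ne (fun h => hy (by simpa using he h))]
      simp [hy]
  simp [bankSum, this, Finset.sum_add_distrib]

theorem bankSum_stepAt_of_ne {b : Bool} {i : Fin n} {u : Fin n → V}
    (h : ∀ x, e (some (b, x)) ≠ i) : bankSum p e b (stepAt f u i) = bankSum p e b u :=
  bankSum_congr fun x => stepAt_of_ne (h x)

theorem bankColor_eq_of_bankSum {c : K} {u : Fin n → V} (h : ∀ b, bankSum p e b u = c) :
    bankColor p e u = c := h _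

/-- The neighbour of colour `c` to which a tuple is attached. Each label occurs twice in each bank,
and the choice between the two copies orients the resulting 4-cycles. -/
def attachTo (p : V → ZMod 2) (f : V → V) (e : Option (Bool × K × Bool) → Fin n) (u : Fin n → V)
    (c : K) : Fin n → V :=
  stepAt f u (e (some (activeBank p e u, c + bankColor p e u,
    decide (p (u (e (some (activeBank p e u, c + bankColor p e u, false))))
      ≠ p (u (e (some (activeBank p e u, c + bankColor p e u, true))))))))

theorem activeBank_attachTo (he : Function.Injective e) (u : Fin n → V) (c : K) :
    activeBank p e (attachTo p f e u c) = activeBank p e u :=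
  activeBank_stepAt_of_ne fun h => by simpa using he h

theorem bankColor_attachTo (he : Function.Injective e) (hp : ∀ v, p (f v) = p v + 1)
    (u : Fin n → V) (c : K) : bankColor p e (attachTo p f e u c) = c := by
  rw [bankColor, activeBank_attachTo he, attachTo, bankSum_stepAt he hp]
  change bankColor p e u + (c + bankColor p e u) = c
  rw [add_comm c, ← add_assoc, ZModModule.add_self, zero_add]

/-- The copy to be changed depends on whether the two copies have different parities. A step toggles
this, so the attachment in the reverse direction changes the other copy. -/
theorem attachTo_attachTo_ne (he : Function.Injective e) (hp : ∀ v, p (f v) = p v + 1)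
    (x y : Fin n → V) (hy : attachTo p f e x (bankColor p e y) = y) :
    attachTo p f e y (bankColor p e x) ≠ x := by
  intro hx
  have hb : activeBank p e y = activeBank p e x := by
    rw [← hy, activeBank_attachTo he]
  rw [attachTo] at hx hy
  rw [hb, add_comm (bankColor p e x)] at hx
  set b := activeBank p e x
  set d := bankColor p e y + bankColor p e x
  set j := decide (p (x (e (some (b, d, false)))) ≠ p (x (e (some (b, d, true))))) with hj
  set j' := decide (p (y (e (some (b, d, false)))) ≠ p (y (e (some (b, d, true))))) with hj'
  have hself : p (y (e (some (b, d, j)))) = p (x (e (some (b, d, j)))) + 1 := by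
    conv_lhs => rw [← hy, stepAt_self, hp]
  have hother : y (e (some (b, d, !j))) = x (e (some (b, d, !j))) := by
    conv_lhs => rw [← hy, stepAt_of_ne (fun h => by simpa using he h)]
  have hjj : j' ≠ j := by
    cases h : j <;> rw [h] at hself hother hj <;>
      simp only [Bool.not_true, Bool.not_false] at hother <;>
      rw [hj', hself, hother] <;> revert hj <;>
      generalize p (x (e (some (b, d, false)))) = a₁ <;>
      generalize p (x (e (some (b, d, true)))) = a₂ <;> revert a₁ a₂ <;> decide
  have hback : x (e (some (b, d, j))) = y (e (some (b, d, j))) := by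
    conv_lhs => rw [← hx, stepAt_of_ne (fun h => hjj (by simpa using (he h).symm))]
  rw [hback] at hself
  simp at hself

/-- If the control is odd, a route to `z` inside the class moves everything outside the control and
the selected bank, then the control, then that bank. An even control costs two preparatory steps. -/
theorem edist_bankColor_class_le (he : Function.Injective e) (hf : ∀ v, H.Adj v (f v))
    (hp : ∀ v, p (f v) = p v + 1) {o : V} (ho : p o = 0) {r : ℕ} (hr : ∀ v, H.edist v o ≤ r)
    (c : K) (z x : {u : Fin n → V | bankColor p e u = c})
    (hz : z.1 = stepAt f (fun _ => o) (e (some (true, c, false)))) :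
    (SimpleGraph.induce {u : Fin n → V | bankColor p e u = c} (cartesianPower H n)).edist x z
      ≤ (n * r + 3 : ℕ) := by
  classical
  set G := SimpleGraph.induce {u : Fin n → V | bankColor p e u = c} (cartesianPower H n)
  have hzS : z.1 (e none) = o := by
    rw [hz, stepAt_of_ne (fun h => by simpa using he h)]
  have hactive : ∀ u : Fin n → V, u (e none) = o → activeBank p e u = true := by
    intro u hu
    simp [activeBank, hu, ho]
  have hzsum : bankSum p e true z.1 = c := by
    have := z.2
    rwa [Set.mem_ofPred_eq, bankColor, hactive _ hzS] at this
  have hdist : ∀ y : Fin n → V, ∑ i, H.edist (y i) (z.1 i) ≤ (n * r + 1 : ℕ) := by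
    intro y
    calc ∑ i, H.edist (y i) (z.1 i)
        ≤ ∑ i, ((r : ℕ∞) + if i = e (some (true, c, false)) then 1 else 0) := by
          refine Finset.sum_le_sum fun i _ => ?_
          rw [hz]
          by_cases hi : i = e (some (true, c, false))
          · subst hi
            rw [stepAt_self, if_pos rfl]
            exact SimpleGraph.edist_triangle.trans
              (add_le_add (hr _) (SimpleGraph.edist_eq_one_iff_adj.2 (hf o)).le)
          · rw [stepAt_of_ne hi, if_neg hi, add_zero]
            exact hr _
      _ = (n * r + 1 : ℕ) := by simp [Finset.sum_add_distrib]
  have hodd : ∀ y : {u : Fin n → V | bankColor p e u = c}, activeBank p e y.1 = false →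
      G.edist y z ≤ (n * r + 1 : ℕ) := by
    intro y hy
    have hysum : bankSum p e false y.1 = c := by
      have := y.2
      rwa [Set.mem_ofPred_eq, bankColor, hy] at this
    let J : Finset (Fin n) := Finset.univ.image fun x => e (some (false, x))
    have hJ : ∀ x, e (some (false, x)) ∈ J := fun x => by simp [J]
    have hSJ : e none ∉ J := by
      simp only [J, Finset.mem_image, Finset.mem_univ, true_and, not_exists]
      exact fun x h => by simpa using he h
    have htJ : ∀ x, e (some (true, x)) ∉ J := by
      intro x
      simp only [J, Finset.mem_image, Finset.mem_univ, true_and, not_exists]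
      exact fun y h => by simpa using he h
    have htS : ∀ b x, e (some (b, x)) ≠ e none := fun b x h => by simpa using he h
    -- `I` contains the unselected bank and all coordinates outside the range of `e`.
    let I := Finset.univ \ insert (e none) J
    have hI : ∀ i, i ∉ I ↔ i = e none ∨ i ∈ J := fun i => by simp [I]; tauto
    have hmem₁ : ∀ u : Fin n → V, (∀ i ∉ I, u i = y.1 i) → bankColor p e u = c := by
      intro u hu
      have h₁ : activeBank p e u = false := by
        rw [activeBank, hu _ ((hI _).2 (Or.inl rfl))]
        exact hy
      rw [bankColor, h₁, ← hysum]
      exact bankSum_congr fun x => hu _ ((hI _).2 (Or.inr (hJ x)))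
    let w₁ : Fin n → V := fun i => if i ∈ I then z.1 i else y.1 i
    have hw₁ : ∀ i ∉ I, w₁ i = y.1 i := fun i hi => if_neg hi
    have hw₁t : ∀ x, w₁ (e (some (true, x))) = z.1 (e (some (true, x))) := fun x =>
      if_pos (by
        by_contra h
        exact ((hI _).1 h).elim (htS _ _) (htJ x))
    -- Both banks now have checksum `c`, so the control entry may be arbitrary.
    have hmem₂ : ∀ u : Fin n → V, (∀ i ∉ ({e none} : Finset (Fin n)), u i = w₁ i) →
        bankColor p e u = c := by
      intro u hu
      refine bankColor_eq_of_bankSum fun b => ?_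
      cases b with
      | true =>
        rw [← hzsum]
        exact bankSum_congr fun x => (hu _ (by simpa using htS _ _)).trans (hw₁t x)
      | false =>
        rw [← hysum]
        exact bankSum_congr fun x => (hu _ (by simpa using htS _ _)).trans
          (hw₁ _ ((hI _).2 (Or.inr (hJ x))))
    let w₂ : Fin n → V := Function.update w₁ (e none) (z.1 (e none))
    have hw₂ : ∀ i ∉ ({e none} : Finset (Fin n)), w₂ i = w₁ i := fun i hi =>
      Function.update_of_ne (by simpa using hi) _ _
    have hw₂z : ∀ i ∉ J, z.1 i = w₂ i := by
      intro i hi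
      by_cases hS : i = e none
      · subst hS; simp [w₂]
      · rw [hw₂ _ (by simpa using hS)]
        refine (if_pos ?_).symm
        by_contra h
        exact ((hI _).1 h).elim hS hi
    have hmem₃ : ∀ u : Fin n → V, (∀ i ∉ J, u i = w₂ i) → bankColor p e u = c := by
      intro u hu
      have hS : u (e none) = o := by rw [hu _ hSJ, ← hw₂z _ hSJ, hzS]
      rw [bankColor, hactive u hS, ← hzsum]
      exact bankSum_congr fun x => (hu _ (htJ x)).trans (hw₂z _ (htJ x)).symm
    have d₁ := edist_induce_cartesianPower_le (H := H) I y ⟨w₁, hmem₁ w₁ hw₁⟩ hw₁ hmem₁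
    have d₂ := edist_induce_cartesianPower_le (H := H) {e none} ⟨w₁, hmem₁ w₁ hw₁⟩
      ⟨w₂, hmem₂ w₂ hw₂⟩ hw₂ hmem₂
    have d₃ := edist_induce_cartesianPower_le (H := H) J ⟨w₂, hmem₂ w₂ hw₂⟩ z hw₂z hmem₃
    -- The three stages move disjoint sets of coordinates, so together they cost only the
    -- coordinatewise distance sum.
    refine le_trans ?_ (hdist y.1)
    have hsplit : ∑ i, H.edist (y.1 i) (z.1 i) = (∑ i ∈ I, H.edist (y.1 i) (z.1 i)) +
        (H.edist (y.1 (e none)) (z.1 (e none)) + ∑ i ∈ J, H.edist (y.1 i) (z.1 i)) := by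
      rw [← Finset.sum_insert (f := fun i => H.edist (y.1 i) (z.1 i)) hSJ]
      exact (Finset.sum_sdiff (Finset.subset_univ _)).symm
    rw [hsplit]
    refine SimpleGraph.edist_triangle.trans (add_le_add (d₁.trans_eq ?_)
      (SimpleGraph.edist_triangle.trans (add_le_add (d₂.trans_eq ?_) (d₃.trans_eq ?_))))
    · exact Finset.sum_congr rfl fun i hi => by simp [w₁, hi]
    · rw [Finset.sum_singleton]
      change H.edist (w₁ (e none)) (w₂ (e none)) = _
      rw [hw₁ _ ((hI _).2 (Or.inl rfl))]
      simp [w₂]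
    · refine Finset.sum_congr rfl fun i hi => ?_
      change H.edist (w₂ i) (z.1 i) = _
      rw [hw₂ i (by rw [Finset.mem_singleton]; rintro rfl; exact hSJ hi),
        hw₁ i ((hI i).2 (Or.inr hi))]
  cases hx : activeBank p e x.1 with
  | false => exact (hodd x hx).trans (by norm_cast; omega)
  | true =>
    have hxsum : bankSum p e true x.1 = c := by
      have := x.2
      rwa [Set.mem_ofPred_eq, bankColor, hx] at this
    -- One flip in the unselected bank corrects its checksum to `c`; the control can then be flipped
    -- within the class.
    let x₁ := stepAt f x.1 (e (some (false, c + bankSum p e false x.1, false)))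
    have hx₁ : ∀ b, bankSum p e b x₁ = c := by
      intro b
      cases b with
      | true =>
        rw [bankSum_stepAt_of_ne fun y h => by simpa using he h, hxsum]
      | false =>
        rw [bankSum_stepAt he hp]
        change bankSum p e false x.1 + (c + bankSum p e false x.1) = c
        rw [add_comm c, ← add_assoc, ZModModule.add_self, zero_add]
    have hx₁a : activeBank p e x₁ = true := by
      rw [activeBank_stepAt_of_ne fun h => by simpa using he h, hx]
    let x₂ := stepAt f x₁ (e none)
    have hx₂ : ∀ b, bankSum p e b x₂ = c := fun b => by
      rw [bankSum_stepAt_of_ne fun y h => by simpa using he h, hx₁]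
    have hx₂a : activeBank p e x₂ = false := by
      rw [activeBank_stepAt hp, hx₁a, Bool.not_true]
    have a₁ : G.Adj x ⟨x₁, bankColor_eq_of_bankSum hx₁⟩ := cartesianPower_adj_stepAt hf _ _
    have a₂ : G.Adj ⟨x₁, bankColor_eq_of_bankSum hx₁⟩ ⟨x₂, bankColor_eq_of_bankSum hx₂⟩ :=
      cartesianPower_adj_stepAt hf _ _
    calc G.edist x z
        ≤ 1 + (1 + (n * r + 1 : ℕ)) :=
          SimpleGraph.edist_triangle.trans (add_le_add (SimpleGraph.edist_eq_one_iff_adj.2 a₁).le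
            (SimpleGraph.edist_triangle.trans (add_le_add
              (SimpleGraph.edist_eq_one_iff_adj.2 a₂).le (hodd _ hx₂a))))
      _ ≤ (n * r + 3 : ℕ) := by norm_cast; omega

theorem exists_completelyIndependent_of_parity (he : Function.Injective e)
    (hf : ∀ v, H.Adj v (f v)) (hp : ∀ v, p (f v) = p v + 1) {o : V} (ho : p o = 0) {r : ℕ}
    (hr : ∀ v, H.edist v o ≤ r) :
    ∃ T : K → SimpleGraph (Fin n → V), (∀ c, IsSpanningTree (cartesianPower H n) (T c)) ∧
      (∀ c d, c ≠ d → CompletelyIndependent (T c) (T d)) ∧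
      ∀ c, (T c).ediam ≤ (2 * (n * r + 3 + 1) : ℕ) := by
  have hctr : ∀ c, bankColor p e (stepAt f (fun _ => o) (e (some (true, c, false)))) = c := by
    intro c
    have h : activeBank p e (stepAt f (fun _ => o) (e (some (true, c, false)))) = true := by
      rw [activeBank_stepAt_of_ne fun h => by simpa using he h]
      simp [activeBank, ho]
    rw [bankColor, h, bankSum_stepAt he hp]
    simp [bankSum, ho]
  exact exists_completelyIndependent_of_coloring _ (bankColor p e) _ hctr (n * r + 3)
    (fun x => edist_bankColor_class_le he hf hp ho hr _ _ _ rfl) (attachTo p f e)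
    (fun x c => cartesianPower_adj_stepAt hf _ _) (bankColor_attachTo he hp)
    fun x y => attachTo_attachTo_ne he hp x y

/-- Parity of the distance to `o`: `f` steps towards `o`, and at `o` to any neighbour. `H` need not
be bipartite, as only the edges `v`–`f v` have to change parity. -/
theorem SimpleGraph.Connected.exists_parity [Nontrivial V] (hH : H.Connected) (o : V) :
    ∃ (p : V → ZMod 2) (f : V → V), p o = 0 ∧ (∀ v, H.Adj v (f v)) ∧ ∀ v, p (f v) = p v + 1 := by
  have hex : ∀ v, ∃ w, H.Adj v w ∧ ((H.dist w o : ℕ) : ZMod 2) = (H.dist v o : ℕ) + 1 := by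
    intro v
    by_cases hv : v = o
    · subst hv
      obtain ⟨w, hw⟩ := hH.preconnected.exists_adj_of_nontrivial v
      exact ⟨w, hw, by simp [SimpleGraph.dist_eq_one_iff_adj.2 hw.symm]⟩
    · obtain ⟨q, hq⟩ := hH.exists_walk_length_eq_dist v o
      cases q with
      | nil => exact absurd rfl hv
      | @cons _ w _ hadj q =>
        have h₁ : H.dist w o ≤ q.length := SimpleGraph.dist_le q
        have h₂ := hH.dist_triangle (u := v) (v := w) (w := o)
        rw [SimpleGraph.dist_eq_one_iff_adj.2 hadj] at h₂
        rw [SimpleGraph.Walk.length_cons] at hq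
        refine ⟨w, hadj, ?_⟩
        rw [show H.dist v o = H.dist w o + 1 by omega]
        push_cast
        rw [add_assoc, ZModModule.add_self, add_zero]
  choose f hadj hf using hex
  exact ⟨fun v => (H.dist v o : ℕ), f, by simp, hadj, hf⟩

theorem exists_completelyIndependent_cartesianPower (hH : H.Connected) {r : ℕ}
    (hr : H.radius = (r : ℕ∞)) {k : ℕ} (hn : 4 * 2 ^ k + 1 ≤ n) :
    ∃ T : Fin (2 ^ k) → SimpleGraph (Fin n → V),
      (∀ i, IsSpanningTree (cartesianPower H n) (T i)) ∧
      (∀ i j, i ≠ j → CompletelyIndependent (T i) (T j)) ∧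
      ∀ i, (T i).ediam ≤ (2 * (n * r + 3 + 1) : ℕ) := by
  have := hH.nonempty
  rcases subsingleton_or_nontrivial V with hV | hV
  · refine ⟨fun _ => ⊥, fun _ => ⟨bot_le, SimpleGraph.IsTree.of_subsingleton⟩,
      fun i j _ => ⟨by simp, fun u v p q _ _ x _ _ => Or.inl (Subsingleton.elim _ _)⟩, fun i => ?_⟩
    rw [SimpleGraph.ediam_eq_zero_of_subsingleton]
    exact zero_le
  obtain ⟨o, ho⟩ := H.exists_eccent_eq_radius
  obtain ⟨p, f, hpo, hf, hp⟩ := hH.exists_parity o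
  have hcardK : Fintype.card (Fin k → ZMod 2) = 2 ^ k := by simp
  obtain ⟨e⟩ : Nonempty (Option (Bool × (Fin k → ZMod 2) × Bool) ↪ Fin n) := by
    refine Function.Embedding.nonempty_of_card_le ?_
    simp only [Fintype.card_option, Fintype.card_prod, hcardK, Fintype.card_bool, Fintype.card_fin]
    omega
  obtain ⟨T, hT, hind, hdiam⟩ := exists_completelyIndependent_of_parity (H := H) e.injective hf hp
    hpo (r := r) fun v => by
      rw [SimpleGraph.edist_comm, ← hr, ← ho]
      exact SimpleGraph.edist_le_eccent
  let g := (Fintype.equivFinOfCardEq hcardK).symm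
  exact ⟨fun i => T (g i), fun i => hT _, fun i j hij => hind _ _ (g.injective.ne hij),
    fun i => hdiam _⟩

end Construction

theorem mainTheorem3 {V : Type*} (H : SimpleGraph V) (hH : H.Connected)
    (r : ℕ) (hr : H.radius = (r : ℕ∞)) :
    (∀ k n : ℕ, 1 ≤ k → 6 * 2 ^ k + k + 4 ≤ n →
      ∃ T : Fin (2 ^ k) → SimpleGraph (Fin n → V),
        (∀ i, IsSpanningTree (cartesianPower H n) (T i)) ∧
        (∀ i j, i ≠ j → CompletelyIndependent (T i) (T j)) ∧
        (∀ i, (T i).ediam ≤ ((2 * (n + 5 * k + 1) * r + 4 * k + 10 : ℕ) : ℕ∞))) ∧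
    (Nontrivial V → ∀ κ : ℕ → ℕ, (∀ᶠ n in atTop, 6 * 2 ^ κ n + κ n + 4 ≤ n) →
      (fun n : ℕ => 2 * ((n : ℝ) + 5 * (κ n : ℝ) + 1) * (r : ℝ) + 4 * (κ n : ℝ) + 10)
        ~[atTop] (fun n : ℕ => 2 * (n : ℝ) * (r : ℝ))) ∧
    (∀ (n : ℕ) (T : SimpleGraph (Fin n → V)), IsSpanningTree (cartesianPower H n) T →
      ((2 * n * r : ℕ) : ℕ∞) ≤ T.ediam + 1) := by
  refine ⟨fun k n _ hn => ?_, fun _ κ hκ => diameter_bound_isEquivalent ?_ hκ,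
    fun n T hT => le_ediam_of_isSpanningTree hH hr hT⟩
  · obtain ⟨T, hT, hind, hdiam⟩ :=
      exists_completelyIndependent_cartesianPower hH hr (k := k) (n := n) (by omega)
    refine ⟨T, hT, hind, fun i => (hdiam i).trans (ENat.natCast_le_natCast.2 ?_)⟩
    -- The slack is `10 * k * r + 2 * r + 4 * k + 2`.
    nlinarith [Nat.zero_le (k * r)]
  · rintro rfl
    exact SimpleGraph.radius_ne_zero_of_nontrivial (by simpa using hr)
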